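/- Let $n\ge 1$, $T>0$, and let $c_{ij}$ ($1\le j\le i\le n$) be real constants. Consider the uncertain chained nonholonomic system $$\dot x_0=u_0,\qquad \dot x_i=u_0x_{i+1}+\phi_i(t,u,x)\ (1\le i\le n-1),\qquad \dot x_n=u+\phi_n(t,u,x),$$ with state $(x_0,x)$, $x=(x_1,\dots,x_n)^{\mathrm T}\in\mathbf R^n$, scalar inputs $u_0,u$, and unknown continuous functions $\phi_i$ satisfying the growth condition $$|\phi_i(t,u,x)|\le c_{i1}|x_1|+\dots+c_{ii}|x_i|\qquad\text{for all } t\in[0,T),\ u\in\mathbf R,\ x\in\mathbf R^n,\ 1\le i\le n .$$ Notation. $A\in\mathbf R^{n\times n}$ has ones on the first superdiagonal and zeros elsewhere, $b=(0,\dots,0,1)^{\mathrm T}\in\mathbf R^n$, $L_n(\gamma)=\mathrm{diag}\{\gamma^{n-1},\gamma^{n-2},\dots,1\}$ and $E_n=\mathrm{diag}\{n-1,n-2,\dots,0\}$. For $\gamma>0$, $P(\gamma)$ is the unique positive definite solution of the parametric Lyapunov equation $A^{\mathrm T}P+PA-Pbb^{\mathrm T}P=-\gamma P$, and $P_n=P(1)$.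 With $\lambda_{\max}$ the largest eigenvalue, put $\Lambda=\lambda_{\max}(P_n)$ and $\delta_{\mathrm c}=n\bigl(1+\lambda_{\max}(E_n+P_nE_nP_n^{-1})\bigr)$. Put $\gamma_0=1/T$, $g_{ij}=c_{ij}T^{i+1-j}$ for $j<i$, $g_{ii}=c_{ii}T+n-i$, and let $d\ge 0$ be given by $$d^2=\max_{1\le j\le n}\ \sum_{i=j}^{n}\frac{g_{ij}^2\, i}{\gamma_0^{2(i-j)}},\qquad\text{and let}\qquad \beta=\frac{2n+\delta_{\mathrm c}}{n}+2d\Lambda .$$ Consider the time-varying state feedback, with $\gamma(t)=\frac1{T-t}$, $$u_0=-\frac{3}{T-t}x_0-\frac{\beta}{2}(T-t),\qquad u=-\beta\, b^{\mathrm T}P(\gamma(t))\,L_n\!\left(\tfrac1{T-t}\right)x .$$ Then this feedback is smooth ($C^\infty$) in time and state for $t<T$, and there are positive constants $\upsilon_1,\upsilon_{10},\upsilon_2,\upsilon_{20}$, depending only on $n$, $T$ and the $c_{ij}$, such that, for all such $\phi_i$ and any initial condition, every solution of the closed-loop system on an interval $[0,\tau)$ with $0<\tau\le T$ satisfies, for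 all $t\in[0,\tau)$, $$|x_0(t)|\le (T-t)^2\left(\frac{T-t}{T^3}|x_0(0)|+\frac{\beta t}{2T}\right),$$ $$|u_0(t)|\le (T-t)\left(3(T-t)\left(\frac{|x_0(0)|}{T^3}+\frac{\beta}{2T}\right)+\beta\right),$$ $$\|x(t)\|\le \upsilon_1 (T-t)^{3/2}\,\mathrm e^{\upsilon_{10}|x_0(0)|t}\,\|x(0)\|,$$ $$|u(t)|\le \upsilon_2 (T-t)^{1/2}\,\mathrm e^{\upsilon_{20}|x_0(0)|t}\,\|x(0)\|,$$ where $\|\cdot\|$ is the Euclidean norm. In particular, for every solution on $[0,T)$, the states $x_0(t),x(t)$ and the controls $u_0(t),u(t)$ converge to zero as $t\to T^-$. -/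

import Mathlib

open Set Filter Topology
open scoped ContDiff Matrix

noncomputable section

namespace ChainedSystem

/-- The upper shift matrix (ones on the first superdiagonal, zeros elsewhere). -/
def A (n : ℕ) : Matrix (Fin n) (Fin n) ℝ :=
  Matrix.of fun i j => if (j : ℕ) = (i : ℕ) + 1 then 1 else 0

/-- The last standard basis vector of `ℝⁿ`. -/
def b (n : ℕ) : Fin n → ℝ := fun i => if (i : ℕ) + 1 = n then 1 else 0

/-- `L_n(γ) = diag {γ^(n-1), γ^(n-2), …, 1}`. -/
def L (n : ℕ) (γ : ℝ) : Matrix (Fin n) (Fin n) ℝ :=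
  Matrix.diagonal fun i => γ ^ (n - 1 - (i : ℕ))

/-- `E_n = diag {n-1, n-2, …, 1, 0}`. -/
def E (n : ℕ) : Matrix (Fin n) (Fin n) ℝ :=
  Matrix.diagonal fun i => (n : ℝ) - 1 - (i : ℝ)

/-- `P` is a positive definite solution of the parametric Lyapunov equation
`AᵀP + PA - P b bᵀ P = -γ P`. -/
def IsPLESolution (n : ℕ) (γ : ℝ) (P : Matrix (Fin n) (Fin n) ℝ) : Prop :=
  P.PosDef ∧
    (A n)ᵀ * P + P * A n - P * Matrix.vecMulVec (b n) (b n) * P = -(γ • P)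

/-- `P(γ)`: the (unique, for `γ > 0`) positive definite solution of the parametric
Lyapunov equation. -/
def P (n : ℕ) (γ : ℝ) : Matrix (Fin n) (Fin n) ℝ :=
  Classical.epsilon (IsPLESolution n γ)

/-- The largest real eigenvalue of a square matrix. -/
def lambdaMax {n : ℕ} (M : Matrix (Fin n) (Fin n) ℝ) : ℝ :=
  sSup {μ : ℝ | Module.End.HasEigenvalue (Matrix.toLin' M) μ}

/-- `δ_c = n (1 + λ_max(E_n + P_n E_n P_n⁻¹))` with `P_n = P(1)`. -/
def deltaC (n : ℕ) : ℝ := n * (1 + lambdaMax (E n + P n 1 * E n * (P n 1)⁻¹))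

/-- `Λ = λ_max(P_n)`. -/
def Lam (n : ℕ) : ℝ := lambdaMax (P n 1)

/-- With one-based indices: `g_ij = c_ij T^(i+1-j)` for `j < i`, and
`g_ii = c_ii T + n - i`. -/
def g {n : ℕ} (c : Fin n → Fin n → ℝ) (T : ℝ) (i j : Fin n) : ℝ :=
  if i = j then c i i * T + ((n : ℝ) - ((i : ℝ) + 1))
  else c i j * T ^ ((i : ℕ) + 1 - (j : ℕ))

/-- `d ≥ 0` with `d² = max_j ∑_{i ≥ j} g_ij² i / γ₀^(2(i-j))` (one-based `i`), `γ₀ = 1/T`. -/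
def d {n : ℕ} (c : Fin n → Fin n → ℝ) (T : ℝ) : ℝ :=
  Real.sqrt (⨆ j : Fin n, ∑ i ∈ Finset.Ici j,
    g c T i j ^ 2 * ((i : ℝ) + 1) / (1 / T) ^ (2 * ((i : ℕ) - (j : ℕ))))

/-- `β = (2n + δ_c)/n + 2 d Λ`. -/
def beta {n : ℕ} (c : Fin n → Fin n → ℝ) (T : ℝ) : ℝ :=
  (2 * n + deltaC n) / n + 2 * d c T * Lam n

/-- `γ(t) = 1/(T-t)`. -/
def gam (T t : ℝ) : ℝ := 1 / (T - t)

/-- First feedback: `u₀ = -3 x₀/(T-t) - (β/2)(T-t)`. -/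
def feedback₀ {n : ℕ} (c : Fin n → Fin n → ℝ) (T t x₀ : ℝ) : ℝ :=
  -(3 / (T - t)) * x₀ - beta c T / 2 * (T - t)

/-- Second feedback: `u = -β bᵀ P(γ(t)) L_n(1/(T-t)) x`. -/
def feedback {n : ℕ} (c : Fin n → Fin n → ℝ) (T t : ℝ)
    (x : EuclideanSpace ℝ (Fin n)) : ℝ :=
  -beta c T * (b n ⬝ᵥ (P n (gam T t) *ᵥ (L n (1 / (T - t)) *ᵥ x.ofLp)))

/-- The growth condition `|φ_i(t,u,x)| ≤ c_i1 |x_1| + ⋯ + c_ii |x_i|`, `t ∈ [0,T)`. -/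
def GrowthCondition {n : ℕ} (c : Fin n → Fin n → ℝ) (T : ℝ)
    (φ : Fin n → ℝ → ℝ → EuclideanSpace ℝ (Fin n) → ℝ) : Prop :=
  ∀ i, ∀ t ∈ Ico 0 T, ∀ (u : ℝ) (x : EuclideanSpace ℝ (Fin n)),
    |φ i t u x| ≤ ∑ j ∈ Finset.Iic i, c i j * |x j|

/-- `(x₀, x)` is a solution on `[0,τ)`, with inputs `u₀` and `u`, of the uncertain chained system
`ẋ₀ = u₀`, `ẋ_i = u₀ x_{i+1} + φ_i(t,u,x)` for `i < n`, `ẋ_n = u + φ_n(t,u,x)`. -/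
structure IsSolution {n : ℕ} (φ : Fin n → ℝ → ℝ → EuclideanSpace ℝ (Fin n) → ℝ) (τ : ℝ)
    (x₀ : ℝ → ℝ) (x : ℝ → EuclideanSpace ℝ (Fin n)) (u₀ u : ℝ → ℝ) : Prop where
  deriv_x₀ : ∀ t ∈ Ico 0 τ, HasDerivWithinAt x₀ (u₀ t) (Ico 0 τ) t
  deriv_x : ∀ t ∈ Ico 0 τ, ∀ i : Fin n,
    HasDerivWithinAt (fun s => x s i)
      ((if h : (i : ℕ) + 1 < n then u₀ t * x t ⟨(i : ℕ) + 1, h⟩ else u t) + φ i t (u t) (x t))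
      (Ico 0 τ) t

/-- A solution on `[0,τ)` of the closed loop formed by the chained system and the feedback. -/
structure IsClosedLoopSolution {n : ℕ} (c : Fin n → Fin n → ℝ) (T : ℝ)
    (φ : Fin n → ℝ → ℝ → EuclideanSpace ℝ (Fin n) → ℝ) (τ : ℝ)
    (x₀ : ℝ → ℝ) (x : ℝ → EuclideanSpace ℝ (Fin n)) (u₀ u : ℝ → ℝ) : Prop
    extends IsSolution φ τ x₀ x u₀ u where
  input₀ : ∀ t ∈ Ico 0 τ, u₀ t = feedback₀ c T t (x₀ t)
  input : ∀ t ∈ Ico 0 τ, u t = feedback c T t (x t)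

end ChainedSystem

end

namespace ChainedSystem

/-! In the coordinates y = L_n(γ)² x the closed loop reads ẏ = γ(E y + (β - ε) A y - β b bᵀP₁ y +
η), with P₁ = P(1). Here u₀γ = β - ε, and η collects the rescaled uncertainty together with a second
copy of E y: differentiating γ^(2k) produces 2kγ^(2k+1), and one half is charged to `lambdaMax`
while the other is charged to `d` through the entries g_ii.

For Q = yᵀP₁y the drift splits into four bounds. The E-term costs λ_max(E + P₁EP₁⁻¹) Q; the Lyapunov
equation turns βA into -βQ + β(bᵀP₁y)²; the feedback contributes -2β(bᵀP₁y)², which absorbs that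
square; and η costs 2dΛ Q. The value of β leaves exactly -3γQ (`pForm_rescaled_field_le`). The
x₀-equation integrates explicitly, and γε turns out to be constant in time, so Q' ≤ (-3γ + k) Q with
k affine in |x₀(0)|. Since γ' = γ², the function γ³ e^(-kt) Q is nonincreasing
(`IsClosedLoopSolution.pForm_le`), and the bounds on x and u follow by taking square roots.

The algebra rests on an explicit formula. The signed binomial matrix N is an involution, P₁ = NᵀN
and P₁⁻¹ = NNᵀ; hence P(γ) = γ L P₁ L, Q = |Ny|², and λ_min(P₁) = 1/Λ, which explains why Λ alone
measures both comparisons of Q with |y|². -/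

/-! ### Binomial identities and the signed binomial involution -/

lemma sum_fin_reflect {R : Type*} [AddCommMonoid R] (n : ℕ) (f : ℕ → R) :
    ∑ i : Fin n, f (n - 1 - (i : ℕ)) = ∑ k ∈ Finset.range n, f k := by
  rw [Fin.sum_univ_eq_sum_range (fun i => f (n - 1 - i)) n, Finset.sum_range_reflect]

lemma sum_choose_mul_pow {R : Type*} [CommRing R] {n m : ℕ} (h : m < n) (y : R) :
    ∑ k ∈ Finset.range n, (m.choose k : R) * y ^ k = (y + 1) ^ m := by
  rw [add_pow, ← Finset.sum_subset (Finset.range_subset_range.2 (Nat.succ_le_of_lt h))]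
  · refine Finset.sum_congr rfl fun k _ => by simp [mul_comm]
  · intro k _ hk
    rw [Nat.choose_eq_zero_of_lt (by simpa using hk)]
    simp

/-- The matrix of the substitution `X ↦ -1 - X` is an involution. -/
lemma sum_signed_choose_mul {n a : ℕ} (b : ℕ) (h : a < n) :
    ∑ k ∈ Finset.range n, ((-1 : ℝ) ^ a * a.choose k) * ((-1) ^ k * k.choose b) =
      if a = b then 1 else 0 := by
  -- The binomial theorem at y = -(X + 1) gives ∑ C(a,k) (-(X+1))^k = (-X)^a; the claim compares
  -- coefficients of X^b.
  have key := congrArg (fun p => p.coeff b)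
    (sum_choose_mul_pow h (-(Polynomial.X + 1 : Polynomial ℝ)))
  simp only [Polynomial.finsetSum_coeff, neg_add_rev] at key
  have h1 : (-1 + -Polynomial.X : Polynomial ℝ) = Polynomial.C (-1) * (Polynomial.X + 1) := by
    simp
  have h2 : (-1 + -Polynomial.X + 1 : Polynomial ℝ) = Polynomial.C (-1) * Polynomial.X := by
    simp
  rw [h2] at key
  simp only [h1, mul_pow, ← Polynomial.C_pow, ← Polynomial.C_eq_natCast,
    Polynomial.coeff_C_mul, Polynomial.coeff_X_add_one_pow, Polynomial.coeff_X_pow] at key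
  calc _ = (-1 : ℝ) ^ a * ∑ k ∈ Finset.range n, (a.choose k : ℝ) * ((-1) ^ k * k.choose b) := by
        rw [Finset.mul_sum]
        exact Finset.sum_congr rfl fun k _ => by ring
    _ = _ := by
        rw [key, ← mul_assoc, ← mul_pow]
        simp [eq_comm]

/-- Vandermonde's convolution after the reflection C(a, a - k) = C(a, k). -/
lemma sum_choose_mul_choose {n a : ℕ} (b : ℕ) (h : a < n) :
    ∑ k ∈ Finset.range n, a.choose k * b.choose k = (a + b).choose a := by
  rw [add_comm a b, Nat.add_choose_eq,
    Finset.Nat.sum_antidiagonal_eq_sum_range_succ (fun i j => b.choose i * a.choose j),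
    ← Finset.sum_subset (Finset.range_subset_range.2 (Nat.succ_le_of_lt h))]
  · refine Finset.sum_congr rfl fun k hk => ?_
    rw [Nat.choose_symm (by simpa [Nat.lt_succ_iff] using hk), mul_comm]
  · intro k _ hk
    rw [Nat.choose_eq_zero_of_lt (by simpa using hk)]
    simp

/-- The signed binomial matrix, with indices counted from the end. -/
def signedBinomial (n : ℕ) : Matrix (Fin n) (Fin n) ℝ :=
  Matrix.of fun i j =>
    (-1 : ℝ) ^ (n - 1 - (i : ℕ)) * ((n - 1 - (i : ℕ)).choose (n - 1 - (j : ℕ)) : ℝ)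

lemma signedBinomial_mul_self (n : ℕ) : signedBinomial n * signedBinomial n = 1 := by
  ext i j
  simp only [signedBinomial, Matrix.mul_apply, Matrix.of_apply]
  have := i.2
  have := j.2
  rw [sum_fin_reflect n (fun k => ((-1 : ℝ) ^ (n - 1 - (i : ℕ)) * (n - 1 - (i : ℕ)).choose k) *
      ((-1) ^ k * k.choose (n - 1 - (j : ℕ)))),
    sum_signed_choose_mul _ (by omega), Matrix.one_apply]
  refine if_congr ?_ rfl rfl
  rw [Fin.ext_iff]
  omega

lemma signedBinomial_mul_transpose_apply (n : ℕ) (i j : Fin n) :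
    (signedBinomial n * (signedBinomial n)ᵀ) i j =
      (-1 : ℝ) ^ (n - 1 - (i : ℕ) + (n - 1 - (j : ℕ))) *
        (n - 1 - (i : ℕ) + (n - 1 - (j : ℕ))).choose (n - 1 - (i : ℕ)) := by
  simp only [signedBinomial, Matrix.mul_apply, Matrix.of_apply, Matrix.transpose_apply]
  have := i.2
  rw [sum_fin_reflect n (fun k => ((-1 : ℝ) ^ (n - 1 - (i : ℕ)) * (n - 1 - (i : ℕ)).choose k) *
      ((-1) ^ (n - 1 - (j : ℕ)) * (n - 1 - (j : ℕ)).choose k)),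
    ← sum_choose_mul_choose _ (show n - 1 - (i : ℕ) < n by omega), Nat.cast_sum, Finset.mul_sum]
  refine Finset.sum_congr rfl fun k _ => ?_
  push_cast
  ring

/-! ### The parametric Lyapunov equation: explicit solution, uniqueness, scaling -/

lemma A_mul_apply {n : ℕ} (W : Matrix (Fin n) (Fin n) ℝ) (i j : Fin n) :
    (A n * W) i j = if h : (i : ℕ) + 1 < n then W ⟨i + 1, h⟩ j else 0 := by
  simp only [A, Matrix.mul_apply, Matrix.of_apply, ite_mul, one_mul, zero_mul]
  split_ifs with h
  · rw [Finset.sum_eq_single ⟨i + 1, h⟩]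
    · simp
    · intro k _ hk
      rw [if_neg (fun h' => hk (Fin.ext h'))]
    · simp
  · refine Finset.sum_eq_zero fun k _ => if_neg ?_
    have := k.2
    omega

lemma mul_transpose_A_apply {n : ℕ} (W : Matrix (Fin n) (Fin n) ℝ) (i j : Fin n) :
    (W * (A n)ᵀ) i j = if h : (j : ℕ) + 1 < n then W i ⟨j + 1, h⟩ else 0 := by
  rw [← Matrix.transpose_apply (W * (A n)ᵀ), Matrix.transpose_mul, Matrix.transpose_transpose,
    A_mul_apply]
  rfl

/-- Pascal's rule: with indices p, q counted from the end, W = NNᵀ has entries (-1)^(p+q) C(p+q, p),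
and A lowers an index by one, so the three terms cancel except in the corner p = q = 0. -/
lemma signedBinomial_mul_transpose_lyapunov (n : ℕ) :
    A n * (signedBinomial n * (signedBinomial n)ᵀ) +
      (signedBinomial n * (signedBinomial n)ᵀ) * (A n)ᵀ +
      signedBinomial n * (signedBinomial n)ᵀ = Matrix.vecMulVec (b n) (b n) := by
  ext i j
  rw [Matrix.add_apply, Matrix.add_apply, A_mul_apply, mul_transpose_A_apply,
    Matrix.vecMulVec_apply]
  simp only [signedBinomial_mul_transpose_apply, b]
  have hi := i.2
  have hj := j.2
  obtain ⟨p, hp⟩ : ∃ p, p = n - 1 - (i : ℕ) := ⟨_, rfl⟩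
  obtain ⟨q, hq⟩ : ∃ q, q = n - 1 - (j : ℕ) := ⟨_, rfl⟩
  rw [← hp, ← hq]
  have e1 : n - 1 - ((i : ℕ) + 1) = p - 1 := by omega
  have e2 : n - 1 - ((j : ℕ) + 1) = q - 1 := by omega
  have c1 : (i : ℕ) + 1 < n ↔ p ≠ 0 := by omega
  have c2 : (j : ℕ) + 1 < n ↔ q ≠ 0 := by omega
  have c3 : (i : ℕ) + 1 = n ↔ p = 0 := by omega
  have c4 : (j : ℕ) + 1 = n ↔ q = 0 := by omega
  simp only [e1, e2, c1, c2, c3, c4]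
  rcases p with _ | p <;> rcases q with _ | q
  · simp
  · simp [pow_succ]
  · simp [pow_succ]
  · have : (p + 1 + (q + 1)).choose (p + 1) = (p + (q + 1)).choose p +
        (p + 1 + q).choose (p + 1) := by
      rw [show p + 1 + (q + 1) = p + 1 + q + 1 by ring, Nat.choose_succ_succ',
        show p + 1 + q = p + (q + 1) by ring]
    rw [this]
    push_cast
    simp [pow_succ, pow_add]
    ring

/-- A is nilpotent: the equation expresses γ D i j through entries with larger i + j, so D vanishes
by descending induction from the last corner. -/
lemma eq_zero_of_homogeneous_lyapunov {n : ℕ} {γ : ℝ} (hγ : 0 < γ)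
    {D : Matrix (Fin n) (Fin n) ℝ} (h : A n * D + D * (A n)ᵀ + γ • D = 0) : D = 0 := by
  have key : ∀ m : ℕ, ∀ i j : Fin n, 2 * n ≤ m + i + j → D i j = 0 := by
    intro m
    induction m with
    | zero =>
      intro i j hm
      have := i.2
      have := j.2
      omega
    | succ m ih =>
      intro i j hm
      have e := congrFun (congrFun h i) j
      rw [Matrix.add_apply, Matrix.add_apply, A_mul_apply, mul_transpose_A_apply,
        Matrix.smul_apply, Matrix.zero_apply] at e
      have h1 : (if h : (i : ℕ) + 1 < n then D ⟨i + 1, h⟩ j else 0) = 0 := by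
        split_ifs with hi
        · exact ih _ _ (by simp only; omega)
        · rfl
      have h2 : (if h : (j : ℕ) + 1 < n then D i ⟨j + 1, h⟩ else 0) = 0 := by
        split_ifs with hj
        · exact ih _ _ (by simp only; omega)
        · rfl
      rw [h1, h2, zero_add, zero_add, smul_eq_mul] at e
      exact (mul_eq_zero.1 e).resolve_left hγ.ne'
  ext i j
  exact key (2 * n) i j (by omega)

/-- Multiplying the quadratic equation by X⁻¹ on both sides makes it linear in X⁻¹, which is what
gives uniqueness. -/
lemma IsPLESolution.inv_lyapunov {n : ℕ} {γ : ℝ} {X : Matrix (Fin n) (Fin n) ℝ}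
    (h : IsPLESolution n γ X) :
    A n * X⁻¹ + X⁻¹ * (A n)ᵀ + γ • X⁻¹ = Matrix.vecMulVec (b n) (b n) := by
  obtain ⟨hX, e⟩ := h
  have hdet : IsUnit X.det := (Matrix.isUnit_iff_isUnit_det X).1 hX.isUnit
  have e' := congrArg (fun Y => X⁻¹ * Y * X⁻¹) e
  simp only [Matrix.mul_sub, Matrix.mul_add, Matrix.sub_mul, Matrix.add_mul, Matrix.mul_neg,
    Matrix.neg_mul, Matrix.mul_smul, Matrix.smul_mul, Matrix.mul_assoc,
    Matrix.mul_nonsing_inv _ hdet, Matrix.nonsing_inv_mul_cancel_left _ _ hdet,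
    Matrix.mul_one] at e'
  rw [add_comm (A n * X⁻¹), ← sub_eq_zero, ← sub_eq_zero.2 e']
  abel

lemma IsPLESolution.unique {n : ℕ} {γ : ℝ} (hγ : 0 < γ) {X Y : Matrix (Fin n) (Fin n) ℝ}
    (hX : IsPLESolution n γ X) (hY : IsPLESolution n γ Y) : X = Y := by
  have h : X⁻¹ - Y⁻¹ = 0 := by
    refine eq_zero_of_homogeneous_lyapunov hγ ?_
    rw [Matrix.mul_sub, Matrix.sub_mul, smul_sub, ← sub_eq_zero.2
      (hX.inv_lyapunov.trans hY.inv_lyapunov.symm)]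
    abel
  exact Matrix.inv_inj (sub_eq_zero.1 h) ((Matrix.isUnit_iff_isUnit_det X).1 hX.1.isUnit)

lemma transpose_signedBinomial_mul_self (n : ℕ) :
    (signedBinomial n)ᵀ * (signedBinomial n)ᵀ = 1 := by
  rw [← Matrix.transpose_mul, signedBinomial_mul_self, Matrix.transpose_one]

lemma gram_mul_inv (n : ℕ) : ((signedBinomial n)ᵀ * signedBinomial n) *
    (signedBinomial n * (signedBinomial n)ᵀ) = 1 := by
  rw [Matrix.mul_assoc, ← Matrix.mul_assoc (signedBinomial n), signedBinomial_mul_self,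
    Matrix.one_mul, transpose_signedBinomial_mul_self]

lemma dotProduct_gram_mulVec {n : ℕ} (M : Matrix (Fin n) (Fin n) ℝ) (x y : Fin n → ℝ) :
    x ⬝ᵥ ((Mᵀ * M) *ᵥ y) = (M *ᵥ x) ⬝ᵥ (M *ᵥ y) := by
  rw [← Matrix.mulVec_mulVec, Matrix.dotProduct_mulVec, Matrix.vecMul_transpose]

lemma posDef_gram {n : ℕ} {M : Matrix (Fin n) (Fin n) ℝ} (hM : ∀ x, M *ᵥ x = 0 → x = 0) :
    (Mᵀ * M).PosDef := by
  refine Matrix.PosDef.of_dotProduct_mulVec_pos ?_ ?_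
  · simpa using Matrix.isHermitian_conjTranspose_mul_self M
  · intro x hx
    rw [star_trivial, dotProduct_gram_mulVec]
    refine lt_of_le_of_ne (Finset.sum_nonneg fun i _ => mul_self_nonneg _) fun h => hx ?_
    exact hM x (dotProduct_self_eq_zero.1 h.symm)

lemma isPLESolution_one (n : ℕ) :
    IsPLESolution n 1 ((signedBinomial n)ᵀ * signedBinomial n) := by
  refine ⟨posDef_gram fun x hx => ?_, ?_⟩
  · rw [← Matrix.one_mulVec x, ← signedBinomial_mul_self, ← Matrix.mulVec_mulVec, hx,
      Matrix.mulVec_zero]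
  · have h := gram_mul_inv n
    have h' := mul_eq_one_comm.1 h
    have e := signedBinomial_mul_transpose_lyapunov n
    set X := (signedBinomial n)ᵀ * signedBinomial n
    set W := signedBinomial n * (signedBinomial n)ᵀ
    rw [← e]
    have h1 (Y : Matrix (Fin n) (Fin n) ℝ) : X * (W * Y) = Y := by
      rw [← Matrix.mul_assoc, h, Matrix.one_mul]
    simp only [Matrix.mul_add, Matrix.add_mul, Matrix.mul_assoc, h', h1, Matrix.mul_one]
    simp
    abel

lemma L_mulVec_b (n : ℕ) (γ : ℝ) : L n γ *ᵥ b n = b n := by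
  ext i
  simp only [L, b, Matrix.mulVec_diagonal]
  split_ifs with h
  · rw [show n - 1 - (i : ℕ) = 0 by omega]
    simp
  · simp

/-- The relations L A = γ A L and L b = b make every term of the equation for γ L X L equal to γ²
L(·)L of the corresponding term for X. -/
lemma isPLESolution_scale {n : ℕ} {γ : ℝ} (hγ : 0 < γ) {X : Matrix (Fin n) (Fin n) ℝ}
    (hX : IsPLESolution n 1 X) : IsPLESolution n γ (γ • (L n γ * X * L n γ)) := by
  obtain ⟨hp, e⟩ := hX
  have hLt : (L n γ)ᵀ = L n γ := by simp [L]
  have hLA : L n γ * A n = γ • (A n * L n γ) := by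
    ext i j
    simp only [L, A, Matrix.diagonal_mul, Matrix.smul_apply, Matrix.mul_diagonal, Matrix.of_apply,
      smul_eq_mul]
    split_ifs with h
    · have := j.2
      rw [show n - 1 - (i : ℕ) = n - 1 - (j : ℕ) + 1 by omega, pow_succ]
      ring
    · ring
  have hAL : (A n)ᵀ * L n γ = γ • (L n γ * (A n)ᵀ) := by
    have := congrArg Matrix.transpose hLA
    simpa [Matrix.transpose_mul, hLt] using this
  have hLb := L_mulVec_b n γ
  have hbb : L n γ * Matrix.vecMulVec (b n) (b n) * L n γ = Matrix.vecMulVec (b n) (b n) := by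
    rw [Matrix.mul_vecMulVec, Matrix.vecMulVec_mul, hLb]
    congr 1
    rw [← Matrix.mulVec_transpose, hLt, hLb]
  refine ⟨?_, ?_⟩
  · refine Matrix.PosDef.of_dotProduct_mulVec_pos ?_ ?_
    · have := hp.1.eq
      rw [Matrix.conjTranspose_eq_transpose_of_trivial] at this
      rw [Matrix.IsHermitian, Matrix.conjTranspose_eq_transpose_of_trivial, Matrix.transpose_smul,
        Matrix.transpose_mul, Matrix.transpose_mul, hLt, this, Matrix.mul_assoc]
    · intro x hx
      rw [star_trivial, Matrix.smul_mulVec, dotProduct_smul, ← Matrix.mulVec_mulVec,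
        ← Matrix.mulVec_mulVec, Matrix.dotProduct_mulVec, ← Matrix.mulVec_transpose, hLt]
      refine smul_pos hγ ?_
      have hne : L n γ *ᵥ x ≠ 0 := by
        intro h0
        refine hx (funext fun i => ?_)
        have := congrFun h0 i
        simp only [L, Matrix.mulVec_diagonal, Pi.zero_apply] at this
        exact (mul_eq_zero.1 this).resolve_left (pow_pos hγ _).ne'
      simpa using hp.dotProduct_mulVec_pos hne
  · have e' := congrArg (fun Y => (γ * γ) • (L n γ * Y * L n γ)) e
    simp only [Matrix.mul_sub, Matrix.mul_add, Matrix.sub_mul, Matrix.add_mul] at e'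
    have t1 : (A n)ᵀ * γ • (L n γ * X * L n γ) = (γ * γ) • (L n γ * ((A n)ᵀ * X) * L n γ) := by
      rw [Matrix.mul_smul, Matrix.mul_assoc (L n γ) X, ← Matrix.mul_assoc (A n)ᵀ, hAL,
        Matrix.smul_mul, smul_smul]
      simp only [Matrix.mul_assoc]
    have t2 : γ • (L n γ * X * L n γ) * A n = (γ * γ) • (L n γ * (X * A n) * L n γ) := by
      rw [Matrix.smul_mul, Matrix.mul_assoc (L n γ * X), hLA, Matrix.mul_smul, smul_smul]
      simp only [Matrix.mul_assoc]
    have t3 : γ • (L n γ * X * L n γ) * Matrix.vecMulVec (b n) (b n) * γ • (L n γ * X * L n γ) =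
        (γ * γ) • (L n γ * (X * Matrix.vecMulVec (b n) (b n) * X) * L n γ) := by
      conv_rhs => rw [← hbb]
      simp only [Matrix.smul_mul, Matrix.mul_smul, smul_smul, Matrix.mul_assoc]
    rw [t1, t2, t3, ← smul_add, ← smul_sub, e']
    simp [smul_smul]

lemma P_eq_of_isPLESolution {n : ℕ} {γ : ℝ} (hγ : 0 < γ) {X : Matrix (Fin n) (Fin n) ℝ}
    (hX : IsPLESolution n γ X) : P n γ = X :=
  (Classical.epsilon_spec (⟨X, hX⟩ : ∃ Y, IsPLESolution n γ Y)).unique hγ hX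

lemma P_one (n : ℕ) : P n 1 = (signedBinomial n)ᵀ * signedBinomial n :=
  P_eq_of_isPLESolution one_pos (isPLESolution_one n)

lemma isPLESolution_P_one (n : ℕ) : IsPLESolution n 1 (P n 1) := by
  rw [P_one]
  exact isPLESolution_one n

lemma P_eq_smul {n : ℕ} {γ : ℝ} (hγ : 0 < γ) : P n γ = γ • (L n γ * P n 1 * L n γ) :=
  P_eq_of_isPLESolution hγ (isPLESolution_scale hγ (isPLESolution_P_one n))

lemma P_one_inv (n : ℕ) : (P n 1)⁻¹ = signedBinomial n * (signedBinomial n)ᵀ := by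
  rw [P_one]
  exact Matrix.inv_eq_right_inv (gram_mul_inv n)

/-! ### Largest eigenvalues and Rayleigh bounds -/

lemma lambdaMax_eq_sSup_spectrum {n : ℕ} (M : Matrix (Fin n) (Fin n) ℝ) :
    lambdaMax M = sSup (spectrum ℝ M) := by
  simp only [lambdaMax, Module.End.hasEigenvalue_iff_mem_spectrum, Set.ofPred_mem_eq,
    Matrix.spectrum_toLin']

lemma le_lambdaMax {n : ℕ} {M : Matrix (Fin n) (Fin n) ℝ} {μ : ℝ} (h : μ ∈ spectrum ℝ M) :
    μ ≤ lambdaMax M := by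
  rw [lambdaMax_eq_sSup_spectrum]
  exact le_csSup (Matrix.finite_spectrum M).bddAbove h

/-- The Rayleigh quotient of a symmetric matrix is bounded by its largest eigenvalue. -/
lemma dotProduct_mulVec_le_lambdaMax {n : ℕ} {S : Matrix (Fin n) (Fin n) ℝ} (hS : Sᵀ = S)
    (x : Fin n → ℝ) : x ⬝ᵥ (S *ᵥ x) ≤ lambdaMax S * (x ⬝ᵥ x) := by
  have hpsd : (algebraMap ℝ (Matrix (Fin n) (Fin n) ℝ) (lambdaMax S) - S).PosSemidef := by
    rw [Matrix.posSemidef_iff_isHermitian_and_spectrum_nonneg]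
    refine ⟨?_, ?_⟩
    · rw [Matrix.IsHermitian, Matrix.conjTranspose_eq_transpose_of_trivial,
        Matrix.transpose_sub, hS, Algebra.algebraMap_eq_smul_one, Matrix.transpose_smul,
        Matrix.transpose_one]
    · rw [← spectrum.singleton_sub_eq]
      rintro _ ⟨_, rfl, μ, hμ, rfl⟩
      exact sub_nonneg.2 (le_lambdaMax hμ)
  have := hpsd.dotProduct_mulVec_nonneg x
  rw [star_trivial, Matrix.sub_mulVec, dotProduct_sub, Algebra.algebraMap_eq_smul_one,
    Matrix.smul_mulVec, Matrix.one_mulVec, dotProduct_smul, smul_eq_mul] at this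
  linarith

lemma lambdaMax_conj {n : ℕ} {U V : Matrix (Fin n) (Fin n) ℝ} (h : U * V = 1)
    (M : Matrix (Fin n) (Fin n) ℝ) : lambdaMax (U * M * V) = lambdaMax M := by
  rw [lambdaMax_eq_sSup_spectrum, lambdaMax_eq_sSup_spectrum]
  have := spectrum.units_conjugate (R := ℝ) (a := M) (u := ⟨U, V, h, mul_eq_one_comm.1 h⟩)
  exact congrArg sSup this

/-! ### The quadratic form of P₁ and its comparison constants -/

/-- The bilinear form `(v, w) ↦ vᵀ P₁ w`, through the factorization of `P₁`. -/
def pForm (n : ℕ) (v w : Fin n → ℝ) : ℝ := (signedBinomial n *ᵥ v) ⬝ᵥ (signedBinomial n *ᵥ w)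

lemma pForm_eq {n : ℕ} (v w : Fin n → ℝ) : pForm n v w = v ⬝ᵥ (P n 1 *ᵥ w) := by
  rw [pForm, P_one, dotProduct_gram_mulVec]

lemma pForm_comm {n : ℕ} (v w : Fin n → ℝ) : pForm n v w = pForm n w v := dotProduct_comm _ _

lemma pForm_add_right {n : ℕ} (v w z : Fin n → ℝ) :
    pForm n v (w + z) = pForm n v w + pForm n v z := by
  simp [pForm, Matrix.mulVec_add]

lemma pForm_smul_right {n : ℕ} (a : ℝ) (v w : Fin n → ℝ) :
    pForm n v (a • w) = a * pForm n v w := by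
  simp [pForm, Matrix.mulVec_smul]

lemma dotProduct_self_nonneg' {n : ℕ} (v : Fin n → ℝ) : 0 ≤ v ⬝ᵥ v :=
  Finset.sum_nonneg fun _ _ => mul_self_nonneg _

lemma pForm_self_nonneg {n : ℕ} (v : Fin n → ℝ) : 0 ≤ pForm n v v := dotProduct_self_nonneg' _

lemma pForm_self_le {n : ℕ} (v : Fin n → ℝ) : pForm n v v ≤ Lam n * (v ⬝ᵥ v) := by
  rw [pForm_eq]
  refine dotProduct_mulVec_le_lambdaMax ?_ v
  rw [P_one]
  simp

/-- `λ_min(P₁) = 1 / λ_max(P₁)`, because `P₁` factors through an involution. -/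
lemma dotProduct_self_le {n : ℕ} (v : Fin n → ℝ) : v ⬝ᵥ v ≤ Lam n * pForm n v v := by
  have h := pForm_self_le (signedBinomial n *ᵥ v)
  simp only [pForm, Matrix.mulVec_mulVec, signedBinomial_mul_self, Matrix.one_mulVec] at h
  exact h

lemma b_dotProduct_self {n : ℕ} (hn : 1 ≤ n) : b n ⬝ᵥ b n = 1 := by
  rw [dotProduct, Finset.sum_eq_single ⟨n - 1, by omega⟩]
  · simp [b, Nat.sub_add_cancel hn]
  · intro i _ hi
    have : (i : ℕ) + 1 ≠ n := fun h => hi (Fin.ext (by simp only; omega))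
    simp [b, this]
  · simp

lemma Lam_pos {n : ℕ} (hn : 1 ≤ n) : 0 < Lam n := by
  have h1 := dotProduct_self_le (b n)
  rw [b_dotProduct_self hn] at h1
  by_contra! h
  nlinarith [pForm_self_nonneg (b n)]

/-- E + P₁EP₁⁻¹ is not symmetric, but conjugation by Nᵀ carries it to the symmetric matrix S = NEN +
NᵀENᵀ, whose Rayleigh quotient at Nx has numerator 2 xᵀP₁Ex. -/
lemma two_mul_pForm_E_le {n : ℕ} (x : Fin n → ℝ) :
    2 * pForm n x (E n *ᵥ x) ≤ lambdaMax (E n + P n 1 * E n * (P n 1)⁻¹) * pForm n x x := by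
  have hEt : (E n)ᵀ = E n := by simp [E]
  set N := signedBinomial n with hN
  have hNN : N * N = 1 := signedBinomial_mul_self n
  have hNN' : Nᵀ * Nᵀ = 1 := transpose_signedBinomial_mul_self n
  set S := N * E n * N + Nᵀ * E n * Nᵀ with hS
  have hSt : Sᵀ = S := by
    simp only [hS, Matrix.transpose_add, Matrix.transpose_mul, hEt, Matrix.transpose_transpose,
      Matrix.mul_assoc]
    rw [add_comm]
  have hconj : lambdaMax (E n + P n 1 * E n * (P n 1)⁻¹) = lambdaMax S := by
    rw [← lambdaMax_conj hNN' S, P_one_inv, P_one, ← hN]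
    congr 1
    have h1 (Y : Matrix (Fin n) (Fin n) ℝ) : Nᵀ * (Nᵀ * Y) = Y := by
      rw [← Matrix.mul_assoc, hNN', Matrix.one_mul]
    simp only [hS, Matrix.mul_add, Matrix.add_mul, Matrix.mul_assoc, h1, hNN', Matrix.mul_one]
    rw [add_comm]
  have h := dotProduct_mulVec_le_lambdaMax hSt (N *ᵥ x)
  rw [← hconj] at h
  have e1 : (N * E n * N) *ᵥ (N *ᵥ x) = N *ᵥ (E n *ᵥ x) := by
    rw [Matrix.mulVec_mulVec, Matrix.mulVec_mulVec, Matrix.mul_assoc, hNN, Matrix.mul_one]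
  have e2 : (N *ᵥ x) ⬝ᵥ ((Nᵀ * E n * Nᵀ) *ᵥ (N *ᵥ x)) =
      (N *ᵥ x) ⬝ᵥ ((N * E n * N) *ᵥ (N *ᵥ x)) := by
    have : Nᵀ * E n * Nᵀ = (N * E n * N)ᵀ := by
      simp only [Matrix.transpose_mul, hEt, Matrix.mul_assoc]
    rw [this, Matrix.mulVec_transpose, dotProduct_comm, ← Matrix.dotProduct_mulVec]
  rw [hS, Matrix.add_mulVec, dotProduct_add, e2, e1] at h
  simp only [pForm]
  rw [← hN]
  linarith

lemma E_mulVec_apply {n : ℕ} (y : Fin n → ℝ) (i : Fin n) :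
    (E n *ᵥ y) i = ((n - 1 - (i : ℕ) : ℕ) : ℝ) * y i := by
  have := i.2
  rw [E, Matrix.mulVec_diagonal, Nat.cast_sub (by omega), Nat.cast_sub (by omega), Nat.cast_one]

/-- Test the preceding bound on b, which E annihilates. -/
lemma lambdaMax_E_conj_nonneg {n : ℕ} (hn : 1 ≤ n) :
    0 ≤ lambdaMax (E n + P n 1 * E n * (P n 1)⁻¹) := by
  have hEb : E n *ᵥ b n = 0 := by
    ext i
    rw [E_mulVec_apply]
    simp only [b, Pi.zero_apply]
    split_ifs with h
    · rw [show n - 1 - (i : ℕ) = 0 by omega]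
      simp
    · simp
  have h := two_mul_pForm_E_le (b n)
  rw [hEb] at h
  have h1 := dotProduct_self_le (b n)
  rw [b_dotProduct_self hn] at h1
  have h0 : 0 < pForm n (b n) (b n) := by
    by_contra! h
    nlinarith [Lam_pos hn]
  simp only [pForm, Matrix.mulVec_zero, dotProduct_zero, mul_zero] at h
  exact nonneg_of_mul_nonneg_left h h0

lemma beta_eq {n : ℕ} (hn : 1 ≤ n) (c : Fin n → Fin n → ℝ) (T : ℝ) :
    beta c T = 3 + lambdaMax (E n + P n 1 * E n * (P n 1)⁻¹) + 2 * d c T * Lam n := by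
  have : (n : ℝ) ≠ 0 := by positivity
  rw [beta, deltaC]
  field_simp
  ring

lemma beta_pos {n : ℕ} (hn : 1 ≤ n) (c : Fin n → Fin n → ℝ) (T : ℝ) : 0 < beta c T := by
  rw [beta_eq hn]
  have h1 := lambdaMax_E_conj_nonneg hn
  have h2 : 0 ≤ d c T := Real.sqrt_nonneg _
  have h3 := Lam_pos hn
  positivity

lemma abs_pForm_mulVec_le {n : ℕ} (hn : 1 ≤ n) (K : Matrix (Fin n) (Fin n) ℝ) :
    ∃ C : ℝ, 0 < C ∧ ∀ y, |2 * pForm n y (K *ᵥ y)| ≤ C * pForm n y y := by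
  set S := P n 1 * K + (P n 1 * K)ᵀ with hS
  have hSt : Sᵀ = S := by rw [hS, Matrix.transpose_add, Matrix.transpose_transpose, add_comm]
  have hSn : (-S)ᵀ = -S := by rw [Matrix.transpose_neg, hSt]
  have e (y : Fin n → ℝ) : y ⬝ᵥ (S *ᵥ y) = 2 * pForm n y (K *ᵥ y) := by
    rw [hS, Matrix.add_mulVec, dotProduct_add, Matrix.mulVec_transpose, dotProduct_comm y (y ᵥ* _),
      ← Matrix.dotProduct_mulVec, pForm_eq, Matrix.mulVec_mulVec]
    ring
  set C := |lambdaMax S| + |lambdaMax (-S)|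
  -- The extra 1 makes the constant strictly positive, as υ₁₀ and υ₂₀ will be proportional to it.
  refine ⟨C * Lam n + 1, add_pos_of_nonneg_of_pos (mul_nonneg (by positivity) (Lam_pos hn).le)
    one_pos, fun y => ?_⟩
  have hq := pForm_self_nonneg y
  have h1 := dotProduct_mulVec_le_lambdaMax hSt y
  have h2 := dotProduct_mulVec_le_lambdaMax hSn y
  rw [Matrix.neg_mulVec, dotProduct_neg] at h2
  rw [e] at h1 h2
  have hy := dotProduct_self_nonneg' y
  have hle := dotProduct_self_le y
  have h3 : C * (y ⬝ᵥ y) ≤ C * (Lam n * pForm n y y) :=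
    mul_le_mul_of_nonneg_left hle (by positivity)
  have h4 : lambdaMax S * (y ⬝ᵥ y) ≤ C * (y ⬝ᵥ y) :=
    mul_le_mul_of_nonneg_right
      ((le_abs_self _).trans (le_add_of_nonneg_right (abs_nonneg _))) hy
  have h5 : lambdaMax (-S) * (y ⬝ᵥ y) ≤ C * (y ⬝ᵥ y) :=
    mul_le_mul_of_nonneg_right
      ((le_abs_self _).trans (le_add_of_nonneg_left (abs_nonneg _))) hy
  rw [abs_le]
  constructor <;> linarith

lemma pForm_sq_le {n : ℕ} (v w : Fin n → ℝ) : pForm n v w ^ 2 ≤ pForm n v v * pForm n w w := by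
  have := Finset.sum_mul_sq_le_sq_mul_sq Finset.univ (signedBinomial n *ᵥ v)
    (signedBinomial n *ᵥ w)
  simpa only [pForm, dotProduct, sq] using this

lemma pForm_le_of_dotProduct_le {n : ℕ} (hn : 1 ≤ n) {δ : ℝ} (hδ : 0 ≤ δ) {y η : Fin n → ℝ}
    (h : η ⬝ᵥ η ≤ δ ^ 2 * (y ⬝ᵥ y)) : pForm n y η ≤ δ * Lam n * pForm n y y := by
  have hL := Lam_pos hn
  have hq := pForm_self_nonneg y
  refine le_of_sq_le_sq ?_ (by positivity)
  calc pForm n y η ^ 2 ≤ pForm n y y * pForm n η η := pForm_sq_le y η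
    _ ≤ pForm n y y * (Lam n * (δ ^ 2 * (Lam n * pForm n y y))) := by
        gcongr
        refine (pForm_self_le η).trans ?_
        gcongr
        exact h.trans (by gcongr; exact dotProduct_self_le y)
    _ = (δ * Lam n * pForm n y y) ^ 2 := by ring

/-! ### Dissipation inequality and the uncertainty bound -/

lemma two_mul_pForm_A {n : ℕ} (y : Fin n → ℝ) :
    2 * pForm n y (A n *ᵥ y) = -pForm n y y + pForm n y (b n) ^ 2 := by
  have e := (isPLESolution_P_one n).2
  have hPt : (P n 1)ᵀ = P n 1 := by rw [P_one]; simp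
  have h := congrArg (fun M => y ⬝ᵥ (M *ᵥ y)) e
  simp only [one_smul, Matrix.sub_mulVec, Matrix.add_mulVec, Matrix.neg_mulVec, dotProduct_sub,
    dotProduct_add, dotProduct_neg] at h
  have h1 : y ⬝ᵥ (((A n)ᵀ * P n 1) *ᵥ y) = pForm n y (A n *ᵥ y) := by
    rw [pForm_comm, pForm_eq, ← Matrix.mulVec_mulVec, Matrix.dotProduct_mulVec,
      Matrix.vecMul_transpose]
  have h2 : y ⬝ᵥ ((P n 1 * A n) *ᵥ y) = pForm n y (A n *ᵥ y) := by
    rw [pForm_eq, Matrix.mulVec_mulVec]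
  have h3 : y ⬝ᵥ ((P n 1 * Matrix.vecMulVec (b n) (b n) * P n 1) *ᵥ y) =
      pForm n y (b n) ^ 2 := by
    rw [← Matrix.mulVec_mulVec, ← Matrix.mulVec_mulVec, Matrix.vecMulVec_mulVec, sq]
    nth_rewrite 2 [pForm_comm]
    rw [pForm_eq, pForm_eq, Matrix.mulVec_smul, dotProduct_smul]
    simp [mul_comm]
  rw [h1, h2, h3, ← pForm_eq] at h
  linarith

/-- The dissipation inequality of the quadratic Lyapunov function along the rescaled dynamics. -/
lemma pForm_rescaled_field_le {n : ℕ} (hn : 1 ≤ n) (c : Fin n → Fin n → ℝ) (T : ℝ) {C : ℝ}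
    (hC : ∀ y, |2 * pForm n y (A n *ᵥ y)| ≤ C * pForm n y y) {γ : ℝ} (hγ : 0 < γ) (ε : ℝ)
    {y η : Fin n → ℝ} (hη : η ⬝ᵥ η ≤ d c T ^ 2 * (y ⬝ᵥ y)) :
    2 * pForm n y (γ • (E n *ᵥ y + (beta c T - ε) • (A n *ᵥ y) +
      (-(beta c T * pForm n y (b n))) • b n + η)) ≤
      (-3 * γ + C * (γ * |ε|)) * pForm n y y := by
  simp only [pForm_smul_right, pForm_add_right]
  have hd : 0 ≤ d c T := Real.sqrt_nonneg _
  have h1 := two_mul_pForm_E_le y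
  have h2 := two_mul_pForm_A y
  have h3 := pForm_le_of_dotProduct_le hn hd hη
  have h4 : -(ε * (2 * pForm n y (A n *ᵥ y))) ≤ |ε| * (C * pForm n y y) := by
    refine (neg_le_abs _).trans ?_
    rw [abs_mul]
    exact mul_le_mul_of_nonneg_left (hC y) (abs_nonneg _)
  have hb := beta_pos hn c T
  have h5 : 0 ≤ beta c T * pForm n y (b n) ^ 2 := by positivity
  have h6 : 2 * pForm n y (E n *ᵥ y) + (beta c T - ε) * (2 * pForm n y (A n *ᵥ y)) -
      2 * (beta c T * pForm n y (b n) ^ 2) + 2 * pForm n y η ≤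
      (-3 + C * |ε|) * pForm n y y := by
    -- By `beta_eq`, β exceeds the costs λ_max(E + P₁EP₁⁻¹) and 2dΛ by exactly 3.
    have hβ := beta_eq hn c T
    have : (beta c T - ε) * (2 * pForm n y (A n *ᵥ y)) =
        -(beta c T * pForm n y y) + beta c T * pForm n y (b n) ^ 2
          + -(ε * (2 * pForm n y (A n *ᵥ y))) := by
      rw [sub_mul]
      nth_rewrite 1 [h2]
      ring
    rw [this]
    have hβ' : beta c T * pForm n y y =
        3 * pForm n y y + lambdaMax (E n + P n 1 * E n * (P n 1)⁻¹) * pForm n y y +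
          2 * (d c T * Lam n * pForm n y y) := by
      rw [hβ]
      ring
    linarith
  have h7 := mul_le_mul_of_nonneg_left h6 hγ.le
  linarith

lemma sum_Iic_comm {n : ℕ} (f : Fin n → Fin n → ℝ) :
    ∑ i, ∑ j ∈ Finset.Iic i, f i j = ∑ j, ∑ i ∈ Finset.Ici j, f i j :=
  Finset.sum_comm' (by simp)

lemma dotProduct_self_le_d_sq {n : ℕ} (c : Fin n → Fin n → ℝ) {T : ℝ} {y η : Fin n → ℝ}
    (h : ∀ i, |η i| ≤ ∑ j ∈ Finset.Iic i, g c T i j * T ^ ((i : ℕ) - (j : ℕ)) * |y j|) :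
    η ⬝ᵥ η ≤ d c T ^ 2 * (y ⬝ᵥ y) := by
  set G : Fin n → ℝ := fun j => ∑ i ∈ Finset.Ici j,
    g c T i j ^ 2 * ((i : ℝ) + 1) / (1 / T) ^ (2 * ((i : ℕ) - (j : ℕ))) with hG
  have hG0 (j : Fin n) : 0 ≤ G j := Finset.sum_nonneg fun i _ => by
    rw [pow_mul]
    positivity
  have hd : d c T ^ 2 = ⨆ j, G j := Real.sq_sqrt (Real.iSup_nonneg hG0)
  have hle (j : Fin n) : G j ≤ d c T ^ 2 := hd ▸ le_ciSup (Set.finite_range G).bddAbove j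
  calc η ⬝ᵥ η = ∑ i, |η i| ^ 2 := by simp [dotProduct, sq]
    _ ≤ ∑ i : Fin n, ∑ j ∈ Finset.Iic i,
          ((i : ℝ) + 1) * (g c T i j * T ^ ((i : ℕ) - (j : ℕ)) * |y j|) ^ 2 := by
        refine Finset.sum_le_sum fun i _ => ?_
        refine (pow_le_pow_left₀ (abs_nonneg _) (h i) 2).trans ?_
        -- Cauchy–Schwarz over the i + 1 (zero-based) indices j ≤ i; this is the weight i in the
        -- definition of d.
        refine sq_sum_le_card_mul_sum_sq.trans (le_of_eq ?_)
        rw [Fin.card_Iic, Finset.mul_sum]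
        push_cast
        rfl
    _ = ∑ j, G j * (y j * y j) := by
        rw [sum_Iic_comm]
        refine Finset.sum_congr rfl fun j _ => ?_
        rw [hG, Finset.sum_mul]
        refine Finset.sum_congr rfl fun i _ => ?_
        rw [mul_pow, mul_pow, sq_abs, one_div, inv_pow, div_inv_eq_mul, mul_comm 2, pow_mul]
        ring
    _ ≤ ∑ j, d c T ^ 2 * (y j * y j) :=
        Finset.sum_le_sum fun j _ => mul_le_mul_of_nonneg_right (hle j) (mul_self_nonneg _)
    _ = d c T ^ 2 * (y ⬝ᵥ y) := by rw [dotProduct, Finset.mul_sum]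

/-- Evaluate the growth bound at the j-th basis vector. The sign is needed to replace T - t by T in
front of `c i j`. -/
lemma GrowthCondition.nonneg {n : ℕ} {c : Fin n → Fin n → ℝ} {T : ℝ} (hT : 0 < T)
    {φ : Fin n → ℝ → ℝ → EuclideanSpace ℝ (Fin n) → ℝ} (h : GrowthCondition c T φ)
    {i j : Fin n} (hij : j ≤ i) : 0 ≤ c i j := by
  have := (abs_nonneg _).trans (h i 0 ⟨le_rfl, hT⟩ 0 (EuclideanSpace.single j 1))
  rw [Finset.sum_eq_single j] at this
  · simpa using this
  · intro k _ hk
    simp [hk]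
  · intro hj
    exact absurd (Finset.mem_Iic.2 hij) hj

/-! ### Rescaled coordinates -/

/-- The state in the coordinates `y = L_n(γ)² x`. -/
def rescale {n : ℕ} (γ : ℝ) (x : Fin n → ℝ) : Fin n → ℝ :=
  fun i => γ ^ (2 * (n - 1 - (i : ℕ))) * x i

lemma rescale_eq {n : ℕ} (γ : ℝ) (x : Fin n → ℝ) : rescale γ x = L n γ *ᵥ (L n γ *ᵥ x) := by
  ext i
  simp only [rescale, L, Matrix.mulVec_diagonal]
  ring

/-- P(γ) = γ L P₁ L supplies a second factor L next to the explicit one, and its left factor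
disappears since L b = b. -/
lemma feedback_eq {n : ℕ} (c : Fin n → Fin n → ℝ) {T t : ℝ} (ht : t < T)
    (x : EuclideanSpace ℝ (Fin n)) :
    feedback c T t x = -beta c T * (gam T t * pForm n (b n) (rescale (gam T t) x.ofLp)) := by
  have hγ : 0 < gam T t := one_div_pos.2 (sub_pos.2 ht)
  have hLt : (L n (gam T t))ᵀ = L n (gam T t) := by simp [L]
  rw [feedback, pForm_eq, rescale_eq, P_eq_smul hγ, ← gam, Matrix.smul_mulVec, dotProduct_smul,
    smul_eq_mul, ← Matrix.mulVec_mulVec, ← Matrix.mulVec_mulVec, Matrix.dotProduct_mulVec,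
    ← Matrix.mulVec_transpose, hLt, L_mulVec_b]

/-- The diagonal drift and the rescaled uncertainty satisfy the bound defining `d`. -/
lemma abs_rescaled_uncertainty_le {n : ℕ} {c : Fin n → Fin n → ℝ} {T t : ℝ} (ht0 : 0 ≤ t)
    (ht : t < T) {φ : Fin n → ℝ → ℝ → EuclideanSpace ℝ (Fin n) → ℝ}
    (h : GrowthCondition c T φ) (u : ℝ) (x : EuclideanSpace ℝ (Fin n)) (i : Fin n) :
    |(E n *ᵥ rescale (gam T t) x.ofLp) i +
      (T - t) * (gam T t ^ (2 * (n - 1 - (i : ℕ))) * φ i t u x)| ≤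
    ∑ j ∈ Finset.Iic i, g c T i j * T ^ ((i : ℕ) - (j : ℕ)) * |rescale (gam T t) x.ofLp j| := by
  have hs : 0 < T - t := sub_pos.2 ht
  have hγ : 0 < gam T t := one_div_pos.2 hs
  have hγs : (T - t) * gam T t = 1 := by rw [gam]; field_simp
  have hTs : T - t ≤ T := by linarith
  set γ := gam T t
  set y := rescale γ x.ofLp with hy
  have h1 : |(E n *ᵥ y) i| = ∑ j ∈ Finset.Iic i,
      if j = i then ((n - 1 - (i : ℕ) : ℕ) : ℝ) * |y j| else 0 := by
    rw [Finset.sum_ite_eq' (Finset.Iic i) i, if_pos (Finset.mem_Iic.2 le_rfl), E_mulVec_apply,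
      abs_mul, Nat.abs_cast]
  have h2 : |(T - t) * (γ ^ (2 * (n - 1 - (i : ℕ))) * φ i t u x)| ≤ ∑ j ∈ Finset.Iic i,
      c i j * (T - t) ^ (1 + 2 * ((i : ℕ) - (j : ℕ))) * |y j| := by
    rw [abs_mul, abs_mul, abs_of_pos hs, abs_of_pos (pow_pos hγ _)]
    refine (mul_le_mul_of_nonneg_left (mul_le_mul_of_nonneg_left (h i t ⟨ht0, ht⟩ u x)
      (pow_pos hγ _).le) hs.le).trans (le_of_eq ?_)
    rw [Finset.mul_sum, Finset.mul_sum]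
    refine Finset.sum_congr rfl fun j hj => ?_
    have hji : (j : ℕ) ≤ i := Fin.le_def.1 (Finset.mem_Iic.1 hj)
    have := i.2
    rw [hy, rescale, abs_mul, abs_of_pos (pow_pos hγ _),
      show 2 * (n - 1 - (j : ℕ)) = 2 * (n - 1 - (i : ℕ)) + 2 * ((i : ℕ) - (j : ℕ)) by omega,
      pow_add, pow_add, pow_one]
    calc _ = c i j * (T - t) * γ ^ (2 * (n - 1 - (i : ℕ))) * |x.ofLp j| * 1 := by ring
      _ = c i j * (T - t) * γ ^ (2 * (n - 1 - (i : ℕ))) * |x.ofLp j| *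
          ((T - t) * γ) ^ (2 * ((i : ℕ) - (j : ℕ))) := by rw [hγs, one_pow]
      _ = _ := by rw [mul_pow]; ring
  refine (abs_add_le _ _).trans ((add_le_add h1.le h2).trans ?_)
  rw [← Finset.sum_add_distrib]
  refine Finset.sum_le_sum fun j hj => ?_
  have hji : (j : ℕ) ≤ i := Fin.le_def.1 (Finset.mem_Iic.1 hj)
  have hc : 0 ≤ c i j := h.nonneg (ht0.trans_lt ht) (Finset.mem_Iic.1 hj)
  have hp : c i j * (T - t) ^ (1 + 2 * ((i : ℕ) - (j : ℕ))) ≤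
      c i j * T ^ (1 + 2 * ((i : ℕ) - (j : ℕ))) :=
    mul_le_mul_of_nonneg_left (pow_le_pow_left₀ hs.le hTs _) hc
  have hp' := mul_le_mul_of_nonneg_right hp (abs_nonneg (y j))
  by_cases hij : j = i
  · subst hij
    have := j.2
    simp only [if_true, g, Nat.sub_self, mul_zero, add_zero, pow_zero, pow_one, mul_one] at hp' ⊢
    have hcast : ((n - 1 - (j : ℕ) : ℕ) : ℝ) = (n : ℝ) - ((j : ℝ) + 1) := by
      rw [Nat.cast_sub (by omega), Nat.cast_sub (by omega), Nat.cast_one]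
      ring
    rw [hcast]
    linarith
  · rw [if_neg hij, zero_add, g, if_neg (Ne.symm hij)]
    refine hp'.trans (le_of_eq ?_)
    rw [mul_assoc (c i j) (T ^ _) (T ^ _), ← pow_add]
    congr 3
    omega

/-! ### Closed-loop trajectories -/

lemma le_of_hasDerivWithinAt_nonpos {τ : ℝ} {f f' : ℝ → ℝ}
    (hf : ∀ t ∈ Ico 0 τ, HasDerivWithinAt f (f' t) (Ico 0 τ) t)
    (hf' : ∀ t ∈ Ico 0 τ, f' t ≤ 0) {t : ℝ} (ht : t ∈ Ico 0 τ) : f t ≤ f 0 := by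
  have hd (s : ℝ) (hs : s ∈ interior (Ico 0 τ)) : HasDerivAt f (f' s) s :=
    (hf s (interior_subset hs)).hasDerivAt (mem_interior_iff_mem_nhds.1 hs)
  have := antitoneOn_of_deriv_nonpos (convex_Ico 0 τ) (fun s hs => (hf s hs).continuousWithinAt)
    (fun s hs => (hd s hs).differentiableAt.differentiableWithinAt)
    (fun s hs => (hd s hs).deriv ▸ hf' s (interior_subset hs))
  exact this ⟨le_rfl, ht.1.trans_lt ht.2⟩ ht ht.1

lemma hasDerivAt_gam {T t : ℝ} (ht : t < T) : HasDerivAt (gam T) (gam T t ^ 2) t := by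
  have hs : T - t ≠ 0 := (sub_pos.2 ht).ne'
  have h := ((hasDerivAt_id t).const_sub T).inv hs
  have e : gam T = fun s => (T - id s)⁻¹ := by
    ext s
    simp [gam]
  rw [e]
  refine h.congr_deriv ?_
  simp [id]

lemma hasDerivAt_gam_pow {T t : ℝ} (ht : t < T) (m : ℕ) :
    HasDerivAt (fun s => gam T s ^ m) (m * gam T t ^ (m + 1)) t := by
  refine ((hasDerivAt_gam ht).pow m).congr_deriv ?_
  rcases m with _ | m
  · simp
  · simp only [Nat.add_sub_cancel]
    ring

section Solution

variable {n : ℕ} {c : Fin n → Fin n → ℝ} {T τ : ℝ}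
  {φ : Fin n → ℝ → ℝ → EuclideanSpace ℝ (Fin n) → ℝ}
  {x₀ : ℝ → ℝ} {x : ℝ → EuclideanSpace ℝ (Fin n)} {u₀ u : ℝ → ℝ}

lemma IsClosedLoopSolution.x₀_eq (hT : 0 < T) (hτ : τ ≤ T)
    (h : IsClosedLoopSolution c T φ τ x₀ x u₀ u) {t : ℝ} (ht : t ∈ Ico 0 τ) :
    x₀ t = (T - t) ^ 2 * ((T - t) / T ^ 3 * x₀ 0 - beta c T * t / (2 * T)) := by
  -- A first integral of the linear x₀-equation: γ³ is its integrating factor, and (β/2)γ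
  -- compensates the forcing term.
  set F : ℝ → ℝ := fun s => x₀ s * gam T s ^ 3 + beta c T / 2 * gam T s with hF
  have hd (s : ℝ) (hs : s ∈ Ico 0 τ) : HasDerivWithinAt F 0 (Ico 0 τ) s := by
    have hsT : s < T := hs.2.trans_le hτ
    have hne : T - s ≠ 0 := (sub_pos.2 hsT).ne'
    refine (((h.deriv_x₀ s hs).mul (hasDerivAt_gam_pow hsT 3).hasDerivWithinAt).add
      ((hasDerivAt_gam hsT).hasDerivWithinAt.const_mul (beta c T / 2))).congr_deriv ?_
    rw [h.input₀ s hs, feedback₀, gam]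
    push_cast
    field_simp
    ring
  have h1 := le_of_hasDerivWithinAt_nonpos hd (fun _ _ => le_rfl) ht
  have h2 := le_of_hasDerivWithinAt_nonpos (fun s hs => (hd s hs).neg) (fun _ _ => by simp) ht
  have he : F t = F 0 := le_antisymm h1 (neg_le_neg_iff.1 h2)
  have hne : T - t ≠ 0 := (sub_pos.2 (ht.2.trans_le hτ)).ne'
  simp only [hF, gam, sub_zero] at he
  field_simp at he ⊢
  linear_combination he

lemma IsClosedLoopSolution.u₀_eq (hT : 0 < T) (hτ : τ ≤ T)
    (h : IsClosedLoopSolution c T φ τ x₀ x u₀ u) {t : ℝ} (ht : t ∈ Ico 0 τ) :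
    u₀ t = (T - t) *
      (beta c T - 3 * (T - t) * (x₀ 0 / T ^ 3 + beta c T / (2 * T))) := by
  have hne : T - t ≠ 0 := (sub_pos.2 (ht.2.trans_le hτ)).ne'
  rw [h.input₀ t ht, feedback₀, h.x₀_eq hT hτ ht]
  field_simp
  ring

lemma IsClosedLoopSolution.hasDerivWithinAt_rescale (hτ : τ ≤ T)
    (h : IsClosedLoopSolution c T φ τ x₀ x u₀ u) {t : ℝ} (ht : t ∈ Ico 0 τ) :
    HasDerivWithinAt (fun s => rescale (gam T s) (x s).ofLp)
      (gam T t • (E n *ᵥ rescale (gam T t) (x t).ofLp +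
        (beta c T - (beta c T - u₀ t * gam T t)) • (A n *ᵥ rescale (gam T t) (x t).ofLp) +
        (-(beta c T * pForm n (rescale (gam T t) (x t).ofLp) (b n))) • b n +
        fun i => (E n *ᵥ rescale (gam T t) (x t).ofLp) i +
          (T - t) * (gam T t ^ (2 * (n - 1 - (i : ℕ))) * φ i t (u t) (x t)))) (Ico 0 τ) t := by
  have htT : t < T := ht.2.trans_le hτ
  have hγs : gam T t * (T - t) = 1 := by
    have := (sub_pos.2 htT).ne'
    rw [gam]
    field_simp
  rw [hasDerivWithinAt_pi]
  intro i
  refine ((hasDerivAt_gam_pow htT (2 * (n - 1 - (i : ℕ)))).hasDerivWithinAt.mul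
    (h.deriv_x t ht i)).congr_deriv ?_
  set γ := gam T t with hγ
  set y := rescale γ (x t).ofLp with hy
  have hyi : y i = γ ^ (2 * (n - 1 - (i : ℕ))) * x t i := rfl
  have hi := i.2
  have hAi : (A n *ᵥ y) i = if h : (i : ℕ) + 1 < n then y ⟨i + 1, h⟩ else 0 := by
    have := A_mul_apply (Matrix.of fun k (_ : Fin n) => y k) i i
    simpa [Matrix.mul_apply, Matrix.mulVec, dotProduct] using this
  simp only [Pi.smul_apply, Pi.add_apply, smul_eq_mul, E_mulVec_apply, hAi]
  have hφ : γ ^ (2 * (n - 1 - (i : ℕ))) * φ i t (u t) (x t) =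
      γ * ((T - t) * (γ ^ (2 * (n - 1 - (i : ℕ))) * φ i t (u t) (x t))) := by
    rw [← mul_assoc γ, hγs, one_mul]
  have hE : ((2 * (n - 1 - (i : ℕ)) : ℕ) : ℝ) * γ ^ (2 * (n - 1 - (i : ℕ)) + 1) * x t i =
      2 * γ * (((n - 1 - (i : ℕ) : ℕ) : ℝ) * y i) := by
    rw [hyi, pow_succ]
    push_cast
    ring
  rw [mul_add, hE]
  by_cases hin : (i : ℕ) + 1 < n
  · have hb : b n i = 0 := if_neg hin.ne
    -- Neighbouring weights differ by γ²: one factor is the common time scale γ, the other joins u₀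
    -- to form u₀γ = β - ε.
    have hy' : γ ^ (2 * (n - 1 - (i : ℕ))) * x t ⟨i + 1, hin⟩ = γ ^ 2 * y ⟨i + 1, hin⟩ := by
      rw [hy, rescale, show 2 * (n - 1 - (i : ℕ)) = 2 + 2 * (n - 1 - ((i : ℕ) + 1)) by omega,
        pow_add, mul_assoc]
    rw [dif_pos hin, dif_pos hin, hb]
    linear_combination u₀ t * hy' + hφ
  · have hb : b n i = 1 := if_pos (by omega)
    have hz : n - 1 - (i : ℕ) = 0 := by omega
    rw [dif_neg hin, dif_neg hin, hb]
    have hu : u t = -beta c T * (γ * pForm n y (b n)) := by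
      rw [h.input t ht, feedback_eq c htT, pForm_comm]
    rw [hz] at hφ ⊢
    simp only [mul_zero, pow_zero, one_mul] at hφ ⊢
    linear_combination hu + hφ

lemma IsClosedLoopSolution.pForm_le (hn : 1 ≤ n) (hT : 0 < T) (hτ : τ ≤ T)
    (hφ : GrowthCondition c T φ) {C : ℝ} (hC0 : 0 < C)
    (hC : ∀ y, |2 * pForm n y (A n *ᵥ y)| ≤ C * pForm n y y)
    (h : IsClosedLoopSolution c T φ τ x₀ x u₀ u) {t : ℝ} (ht : t ∈ Ico 0 τ) :
    pForm n (rescale (gam T t) (x t).ofLp) (rescale (gam T t) (x t).ofLp) ≤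
      ((T - t) / T) ^ 3 * Real.exp (3 * C * (|x₀ 0| / T ^ 3 + beta c T / (2 * T)) * t) *
        pForm n (rescale (1 / T) (x 0).ofLp) (rescale (1 / T) (x 0).ofLp) := by
  set k := 3 * C * (|x₀ 0| / T ^ 3 + beta c T / (2 * T)) with hk
  set y : ℝ → Fin n → ℝ := fun s => rescale (gam T s) (x s).ofLp with hy
  set Q : ℝ → ℝ := fun s => pForm n (y s) (y s) with hQ
  have hQd (s : ℝ) (hs : s ∈ Ico 0 τ) : ∃ q, HasDerivWithinAt Q q (Ico 0 τ) s ∧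
      q ≤ (-3 * gam T s + k) * Q s := by
    have hsT : s < T := hs.2.trans_le hτ
    have hs0 : 0 < T - s := sub_pos.2 hsT
    have hγ : 0 < gam T s := one_div_pos.2 hs0
    have hd := h.hasDerivWithinAt_rescale hτ hs
    set w := gam T s • (_ : Fin n → ℝ) with hw
    have hN (i : Fin n) : HasDerivWithinAt (fun r => (signedBinomial n *ᵥ y r) i)
        ((signedBinomial n *ᵥ w) i) (Ico 0 τ) s := by
      simp only [Matrix.mulVec, dotProduct]
      exact HasDerivWithinAt.fun_sum fun j _ => ((hasDerivWithinAt_pi.1 hd) j).const_mul _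
    refine ⟨2 * pForm n (y s) w, ?_, ?_⟩
    · have := HasDerivWithinAt.fun_sum (u := Finset.univ) fun i _ => (hN i).mul (hN i)
      refine this.congr_deriv ?_
      rw [pForm, dotProduct, Finset.mul_sum]
      exact Finset.sum_congr rfl fun i _ => by ring
    · have hη := dotProduct_self_le_d_sq c
        (abs_rescaled_uncertainty_le hs.1 hsT hφ (u s) (x s))
      refine (pForm_rescaled_field_le hn c T hC hγ _ hη).trans ?_
      refine mul_le_mul_of_nonneg_right ?_ (pForm_self_nonneg _)
      have hε : gam T s * |beta c T - u₀ s * gam T s| ≤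
          3 * (|x₀ 0| / T ^ 3 + beta c T / (2 * T)) := by
        -- The factor T - s in ε cancels γ, so the perturbation of the drift is constant rather than
        -- singular at T.
        have : gam T s * (beta c T - u₀ s * gam T s) =
            3 * (x₀ 0 / T ^ 3 + beta c T / (2 * T)) := by
          rw [h.u₀_eq hT hτ hs, gam]
          field_simp
          ring
        rw [← abs_of_pos hγ, ← abs_mul, abs_of_pos hγ, this, abs_mul, abs_of_pos three_pos]
        refine mul_le_mul_of_nonneg_left ((abs_add_le _ _).trans_eq ?_) three_pos.le
        have hβ := beta_pos hn c T
        have hβT : 0 < beta c T / (2 * T) := by positivity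
        rw [abs_div, abs_of_pos (pow_pos hT 3), abs_of_pos hβT]
      have := mul_le_mul_of_nonneg_left hε hC0.le
      rw [hk]
      linarith
  choose! q hq hq' using hQd
  -- Integrating factor for Q' ≤ (-3γ + k) Q, using (γ³)' = 3γ⁴.
  have hF := le_of_hasDerivWithinAt_nonpos
    (f := fun s => Q s * gam T s ^ 3 * Real.exp (-k * s))
    (f' := fun s => (q s + (3 * gam T s - k) * Q s) * (gam T s ^ 3 * Real.exp (-k * s)))
    (fun s hs => by
      have he : HasDerivAt (fun r : ℝ => Real.exp (-k * r)) (Real.exp (-k * s) * (-k)) s := by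
        simpa using ((hasDerivAt_id s).const_mul (-k)).exp
      refine (((hq s hs).mul (hasDerivAt_gam_pow (hs.2.trans_le hτ) 3).hasDerivWithinAt).mul
        he.hasDerivWithinAt).congr_deriv ?_
      simp only [Pi.mul_apply]
      push_cast
      ring)
    (fun s hs => by
      have hγ : 0 < gam T s := one_div_pos.2 (sub_pos.2 (hs.2.trans_le hτ))
      refine mul_nonpos_of_nonpos_of_nonneg ?_ (by positivity)
      linarith [hq' s hs])
    ht
  have hs0 : 0 < T - t := sub_pos.2 (ht.2.trans_le hτ)
  have hQ0 : Q 0 = pForm n (rescale (1 / T) (x 0).ofLp) (rescale (1 / T) (x 0).ofLp) := by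
    simp [hQ, hy, gam]
  rw [← hQ0]
  simp only [mul_zero, Real.exp_zero, mul_one, neg_mul, Real.exp_neg] at hF
  simp only [gam, sub_zero] at hF
  change Q t ≤ _
  have e : Q t = (T - t) ^ 3 * Real.exp (k * t) * (Q t * (1 / (T - t)) ^ 3 *
      (Real.exp (k * t))⁻¹) := by
    field_simp
  rw [e]
  refine (mul_le_mul_of_nonneg_left hF (by positivity)).trans_eq ?_
  field_simp

end Solution

/-! ### Return to the original coordinates -/

lemma rescale_dotProduct_self_le {n : ℕ} {γ M : ℝ} (hγ : 0 ≤ γ) (hM : 1 ≤ M) (hγM : γ ≤ M)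
    (x : Fin n → ℝ) : rescale γ x ⬝ᵥ rescale γ x ≤ M ^ (4 * n) * (x ⬝ᵥ x) := by
  simp only [dotProduct, Finset.mul_sum, rescale]
  refine Finset.sum_le_sum fun i _ => ?_
  have h1 : γ ^ (4 * (n - 1 - (i : ℕ))) ≤ M ^ (4 * n) :=
    (pow_le_pow_left₀ hγ hγM _).trans (pow_le_pow_right₀ hM (by omega))
  refine le_of_eq_of_le ?_ (mul_le_mul_of_nonneg_right h1 (mul_self_nonneg (x i)))
  rw [show 4 * (n - 1 - (i : ℕ)) = 2 * (n - 1 - (i : ℕ)) + 2 * (n - 1 - (i : ℕ)) by ring, pow_add]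
  ring

lemma rescale_rescale {n : ℕ} {γ δ : ℝ} (h : δ * γ = 1) (x : Fin n → ℝ) :
    rescale δ (rescale γ x) = x := by
  ext i
  rw [rescale, rescale, ← mul_assoc, ← mul_pow, h, one_pow, one_mul]

lemma norm_sq_eq_dotProduct {n : ℕ} (x : EuclideanSpace ℝ (Fin n)) :
    ‖x‖ ^ 2 = x.ofLp ⬝ᵥ x.ofLp := by
  rw [EuclideanSpace.real_norm_sq_eq, dotProduct]
  exact Finset.sum_congr rfl fun i _ => sq _

/-- Square roots halve the exponents; e^(et) ≤ e^(eT) moves the part of the rate independent of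
x₀(0) into the constant. -/
lemma abs_le_of_sq_le_exp {r D s N a e t T : ℝ} (m : ℕ) (hD : 0 ≤ D) (hs : 0 ≤ s) (hN : 0 ≤ N)
    (he : 0 ≤ e) (ht : t ≤ T)
    (h : r ^ 2 ≤ D * s ^ m * Real.exp ((a + e) * t) * N ^ 2) :
    |r| ≤ (√D * Real.exp (e * T / 2)) * s ^ ((m : ℝ) / 2) * Real.exp (a / 2 * t) * N := by
  refine abs_le_of_sq_le_sq (h.trans ?_) (by positivity)
  have h1 : (s ^ ((m : ℝ) / 2)) ^ 2 = s ^ m := by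
    rw [← Real.rpow_natCast, ← Real.rpow_mul hs]
    push_cast
    rw [div_mul_cancel₀ _ two_ne_zero, Real.rpow_natCast]
  rw [mul_pow, mul_pow, mul_pow, mul_pow, h1, Real.sq_sqrt hD, ← Real.exp_nat_mul,
    ← Real.exp_nat_mul]
  have h2 : Real.exp ((a + e) * t) ≤
      Real.exp ((2 : ℕ) * (e * T / 2)) * Real.exp ((2 : ℕ) * (a / 2 * t)) := by
    rw [← Real.exp_add]
    refine Real.exp_le_exp.2 ?_
    push_cast
    nlinarith [mul_le_mul_of_nonneg_left ht he]
  calc _ ≤ D * s ^ m * (Real.exp ((2 : ℕ) * (e * T / 2)) * Real.exp ((2 : ℕ) * (a / 2 * t))) *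
        N ^ 2 := by gcongr
    _ = _ := by ring

/-! ### Smoothness of the feedback -/

lemma contDiffOn_feedback₀ {n : ℕ} (c : Fin n → Fin n → ℝ) (T : ℝ) :
    ContDiffOn ℝ ∞ (fun p : ℝ × ℝ => feedback₀ c T p.1 p.2) (Iio T ×ˢ univ) := by
  have h : ContDiffOn ℝ ∞ (fun p : ℝ × ℝ => 3 / (T - p.1)) (Iio T ×ˢ univ) :=
    contDiffOn_const.div (by fun_prop) fun p hp => (sub_pos.2 hp.1).ne'
  simp only [feedback₀]
  exact (h.neg.mul contDiffOn_snd).sub (by fun_prop)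

lemma contDiffOn_feedback {n : ℕ} (c : Fin n → Fin n → ℝ) (T : ℝ) :
    ContDiffOn ℝ ∞ (fun p : ℝ × EuclideanSpace ℝ (Fin n) => feedback c T p.1 p.2)
      (Iio T ×ˢ univ) := by
  have h : ContDiffOn ℝ ∞ (fun p : ℝ × EuclideanSpace ℝ (Fin n) => gam T p.1)
      (Iio T ×ˢ univ) :=
    contDiffOn_const.div (by fun_prop) fun p hp => (sub_pos.2 hp.1).ne'
  have h2 : ContDiffOn ℝ ∞ (fun p : ℝ × EuclideanSpace ℝ (Fin n) => -beta c T * (gam T p.1 *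
      ∑ i, b n i * ∑ j, P n 1 i j * (gam T p.1 ^ (2 * (n - 1 - (j : ℕ))) * p.2 j)))
      (Iio T ×ˢ univ) := by
    refine contDiffOn_const.mul (h.mul (ContDiffOn.sum fun i _ => contDiffOn_const.mul
      (ContDiffOn.sum fun j _ => contDiffOn_const.mul ((h.pow _).mul ?_))))
    fun_prop
  refine h2.congr fun p hp => ?_
  rw [feedback_eq c hp.1, pForm_eq]
  rfl

end ChainedSystem

/-! ### The main theorem -/

theorem theorem1 (n : ℕ) (hn : 1 ≤ n) (T : ℝ) (hT : 0 < T) (c : Fin n → Fin n → ℝ) :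
    -- the feedback is smooth in time and state, for `t < T`
    ContDiffOn ℝ ∞ (fun p : ℝ × ℝ => ChainedSystem.feedback₀ c T p.1 p.2) (Iio T ×ˢ univ) ∧
    ContDiffOn ℝ ∞ (fun p : ℝ × EuclideanSpace ℝ (Fin n) =>
      ChainedSystem.feedback c T p.1 p.2) (Iio T ×ˢ univ) ∧
    ∃ υ₁ > 0, ∃ υ₁₀ > 0, ∃ υ₂ > 0, ∃ υ₂₀ > 0,
      ∀ φ : Fin n → ℝ → ℝ → EuclideanSpace ℝ (Fin n) → ℝ,
        (∀ i, ContinuousOn (fun p : ℝ × ℝ × EuclideanSpace ℝ (Fin n) => φ i p.1 p.2.1 p.2.2)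
          (Ico 0 T ×ˢ univ)) →
        ChainedSystem.GrowthCondition c T φ →
        ∀ τ ∈ Ioc 0 T, ∀ (x₀ : ℝ → ℝ) (x : ℝ → EuclideanSpace ℝ (Fin n)) (u₀ u : ℝ → ℝ),
          ChainedSystem.IsClosedLoopSolution c T φ τ x₀ x u₀ u →
          (∀ t ∈ Ico 0 τ,
            |x₀ t| ≤ (T - t) ^ 2 *
              ((T - t) / T ^ 3 * |x₀ 0| + ChainedSystem.beta c T * t / (2 * T)) ∧
            |u₀ t| ≤ (T - t) *
              (3 * (T - t) * (|x₀ 0| / T ^ 3 + ChainedSystem.beta c T / (2 * T))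
                + ChainedSystem.beta c T) ∧
            ‖x t‖ ≤ υ₁ * (T - t) ^ (3 / 2 : ℝ) * Real.exp (υ₁₀ * |x₀ 0| * t) * ‖x 0‖ ∧
            |u t| ≤ υ₂ * (T - t) ^ (1 / 2 : ℝ) * Real.exp (υ₂₀ * |x₀ 0| * t) * ‖x 0‖) ∧
          -- a solution on the whole of `[0,T)`: states and controls reach zero at time `T`
          (τ = T →
            Tendsto x₀ (𝓝[<] T) (𝓝 0) ∧ Tendsto x (𝓝[<] T) (𝓝 0) ∧
            Tendsto u₀ (𝓝[<] T) (𝓝 0) ∧ Tendsto u (𝓝[<] T) (𝓝 0)) := by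
  have hC := ChainedSystem.abs_pForm_mulVec_le hn (ChainedSystem.A n)
  obtain ⟨C, hC0, hC⟩ := hC
  have hβ := ChainedSystem.beta_pos hn c T
  have hΛ := ChainedSystem.Lam_pos hn
  refine ⟨ChainedSystem.contDiffOn_feedback₀ c T, ChainedSystem.contDiffOn_feedback c T, ?_⟩
  set Λ := ChainedSystem.Lam n
  set β := ChainedSystem.beta c T
  -- The part of the growth rate k that does not involve x₀(0).
  set e : ℝ := 3 * C * (β / (2 * T)) with he
  -- The common factor Λ max(1, 1/T)^(4n) / T³ bounds Q(0) by ‖x(0)‖² and includes the decay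
  -- factor's T⁻³. The other Λ bounds bᵀP₁b in D₂ and |y|²/Q in D₁; max(1, T)^(4n) undoes the
  -- rescaling.
  set D₂ : ℝ := β ^ 2 * (Λ * (Λ * max 1 (1 / T) ^ (4 * n))) / T ^ 3 with hD₂
  set D₁ : ℝ := max 1 T ^ (4 * n) * (Λ * (Λ * max 1 (1 / T) ^ (4 * n))) / T ^ 3 with hD₁
  have hM : 0 < max 1 T := zero_lt_one.trans_le (le_max_left _ _)
  have hM' : 0 < max 1 (1 / T) := zero_lt_one.trans_le (le_max_left _ _)
  have hD₁0 : 0 < D₁ := by positivity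
  have hD₂0 : 0 < D₂ := by positivity
  have he0 : 0 < e := by positivity
  have hυ : 0 < 3 * C / T ^ 3 / 2 := by positivity
  refine ⟨√D₁ * Real.exp (e * T / 2), by positivity, 3 * C / T ^ 3 / 2, hυ,
    √D₂ * Real.exp (e * T / 2), by positivity, 3 * C / T ^ 3 / 2, hυ, ?_⟩
  intro φ _ hφ τ hτ x₀ x u₀ u h
  have hbounds : ∀ t ∈ Ico 0 τ,
      |x₀ t| ≤ (T - t) ^ 2 * ((T - t) / T ^ 3 * |x₀ 0| + β * t / (2 * T)) ∧
      |u₀ t| ≤ (T - t) * (3 * (T - t) * (|x₀ 0| / T ^ 3 + β / (2 * T)) + β) ∧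
      ‖x t‖ ≤ √D₁ * Real.exp (e * T / 2) * (T - t) ^ (3 / 2 : ℝ) *
        Real.exp (3 * C / T ^ 3 / 2 * |x₀ 0| * t) * ‖x 0‖ ∧
      |u t| ≤ √D₂ * Real.exp (e * T / 2) * (T - t) ^ (1 / 2 : ℝ) *
        Real.exp (3 * C / T ^ 3 / 2 * |x₀ 0| * t) * ‖x 0‖ := by
    intro t ht
    have htT : t < T := ht.2.trans_le hτ.2
    have hs : 0 < T - t := sub_pos.2 htT
    have ht0 := ht.1
    have hQ := h.pForm_le hn hT hτ.2 hφ hC0 hC ht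
    set y := ChainedSystem.rescale (ChainedSystem.gam T t) (x t).ofLp with hy
    have hQ0 : ChainedSystem.pForm n (ChainedSystem.rescale (1 / T) (x 0).ofLp)
        (ChainedSystem.rescale (1 / T) (x 0).ofLp) ≤
        Λ * (max 1 (1 / T) ^ (4 * n) * ‖x 0‖ ^ 2) := by
      refine (ChainedSystem.pForm_self_le _).trans (mul_le_mul_of_nonneg_left ?_ hΛ.le)
      rw [ChainedSystem.norm_sq_eq_dotProduct]
      exact ChainedSystem.rescale_dotProduct_self_le (by positivity) (le_max_left _ _)
        (le_max_right _ _) _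
    have hexp : 3 * C * (|x₀ 0| / T ^ 3 + β / (2 * T)) = 3 * C / T ^ 3 * |x₀ 0| + e := by
      rw [he]
      ring
    rw [hexp] at hQ
    have hQ' := hQ.trans (mul_le_mul_of_nonneg_left hQ0 (by positivity))
    refine ⟨?_, ?_, ?_, ?_⟩
    · rw [h.x₀_eq hT hτ.2 ht, abs_mul, abs_of_pos (pow_pos hs 2)]
      refine mul_le_mul_of_nonneg_left ((abs_sub _ _).trans_eq ?_) (by positivity)
      have h1 : 0 ≤ β * t / (2 * T) := by positivity
      rw [abs_mul, abs_of_pos (div_pos hs (pow_pos hT 3)), abs_of_nonneg h1]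
    · rw [h.u₀_eq hT hτ.2 ht, abs_mul, abs_of_pos hs]
      refine mul_le_mul_of_nonneg_left ((abs_sub _ _).trans ?_) hs.le
      have h1 : 0 < β / (2 * T) := by positivity
      have h2 : |x₀ 0 / T ^ 3 + β / (2 * T)| ≤ |x₀ 0| / T ^ 3 + β / (2 * T) := by
        refine (abs_add_le _ _).trans_eq ?_
        rw [abs_div, abs_of_pos (pow_pos hT 3), abs_of_pos h1]
      rw [abs_of_pos hβ, abs_mul, abs_of_pos (mul_pos three_pos hs), add_comm]
      gcongr
    · have hx : ‖x t‖ ^ 2 ≤ D₁ * (T - t) ^ 3 *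
          Real.exp ((3 * C / T ^ 3 * |x₀ 0| + e) * t) * ‖x 0‖ ^ 2 := by
        have hγs : (T - t) * ChainedSystem.gam T t = 1 := by
          rw [ChainedSystem.gam]
          field_simp
        have h1 : ‖x t‖ ^ 2 ≤ max 1 T ^ (4 * n) * (y ⬝ᵥ y) := by
          rw [ChainedSystem.norm_sq_eq_dotProduct]
          have := ChainedSystem.rescale_dotProduct_self_le hs.le (le_max_left 1 T)
            (le_max_of_le_right (by linarith)) y
          rwa [hy, ChainedSystem.rescale_rescale hγs] at this
        refine h1.trans ((mul_le_mul_of_nonneg_left ((ChainedSystem.dotProduct_self_le y).trans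
          (mul_le_mul_of_nonneg_left hQ' hΛ.le)) (by positivity)).trans_eq ?_)
        rw [hD₁]
        field_simp
        rfl
      have := ChainedSystem.abs_le_of_sq_le_exp 3 hD₁0.le hs.le (norm_nonneg _) he0.le htT.le hx
      rw [abs_norm] at this
      refine this.trans_eq ?_
      push_cast
      ring_nf
    · have hu : u t ^ 2 ≤ D₂ * (T - t) ^ 1 *
          Real.exp ((3 * C / T ^ 3 * |x₀ 0| + e) * t) * ‖x 0‖ ^ 2 := by
        have hb := ChainedSystem.pForm_self_le (ChainedSystem.b n)
        rw [ChainedSystem.b_dotProduct_self hn, mul_one] at hb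
        -- Cauchy–Schwarz for P₁ gives (bᵀP₁y)² ≤ Λ Q; the prefactor γ² of u² leaves one of the
        -- three powers of T - t.
        have hsq := (ChainedSystem.pForm_sq_le (ChainedSystem.b n) y).trans
          (mul_le_mul hb hQ' (ChainedSystem.pForm_self_nonneg y) hΛ.le)
        rw [h.input t ht, ChainedSystem.feedback_eq c htT, mul_pow, mul_pow, neg_sq]
        refine (mul_le_mul_of_nonneg_left (mul_le_mul_of_nonneg_left hsq (sq_nonneg _))
          (sq_nonneg _)).trans_eq ?_
        rw [hD₂, ChainedSystem.gam]
        field_simp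
        change β ^ 2 * Λ * _ = _
        ring
      have := ChainedSystem.abs_le_of_sq_le_exp 1 hD₂0.le hs.le (norm_nonneg _) he0.le htT.le hu
      refine this.trans_eq ?_
      push_cast
      ring_nf
  refine ⟨hbounds, ?_⟩
  rintro rfl
  have hmem : Ico 0 τ ∈ 𝓝[<] τ := mem_of_superset (Ioo_mem_nhdsLT hT) Ioo_subset_Ico_self
  have hlim {f : ℝ → ℝ} (hf : ContinuousAt f τ) (h0 : f τ = 0) : Tendsto f (𝓝[<] τ) (𝓝 0) := by
    have := hf.tendsto.mono_left (nhdsWithin_le_nhds (s := Iio τ))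
    rwa [h0] at this
  have hpow {p : ℝ} (hp : 0 < p) : ContinuousAt (fun t : ℝ => (τ - t) ^ p) τ :=
    (continuousAt_const.sub continuousAt_id).rpow_const (Or.inr hp.le)
  refine ⟨?_, ?_, ?_, ?_⟩
  · refine squeeze_zero_norm' (a := fun t => (τ - t) ^ 2 * ((τ - t) / τ ^ 3 * |x₀ 0| +
      β * t / (2 * τ))) (by filter_upwards [hmem] with t ht using (hbounds t ht).1) (hlim ?_ ?_)
    · fun_prop
    · simp
  · refine squeeze_zero_norm' (a := fun t => √D₁ * Real.exp (e * τ / 2) * (τ - t) ^ (3 / 2 : ℝ) *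
      Real.exp (3 * C / τ ^ 3 / 2 * |x₀ 0| * t) * ‖x 0‖)
      (by filter_upwards [hmem] with t ht using (hbounds t ht).2.2.1) (hlim ?_ ?_)
    · exact ((continuousAt_const.mul (hpow (by norm_num))).mul (by fun_prop)).mul
        continuousAt_const
    · rw [sub_self, Real.zero_rpow (by norm_num)]
      simp
  · refine squeeze_zero_norm' (a := fun t => (τ - t) * (3 * (τ - t) * (|x₀ 0| / τ ^ 3 +
      β / (2 * τ)) + β)) (by filter_upwards [hmem] with t ht using (hbounds t ht).2.1) (hlim ?_ ?_)
    · fun_prop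
    · simp
  · refine squeeze_zero_norm' (a := fun t => √D₂ * Real.exp (e * τ / 2) * (τ - t) ^ (1 / 2 : ℝ) *
      Real.exp (3 * C / τ ^ 3 / 2 * |x₀ 0| * t) * ‖x 0‖)
      (by filter_upwards [hmem] with t ht using (hbounds t ht).2.2.2) (hlim ?_ ?_)
    · exact ((continuousAt_const.mul (hpow (by norm_num))).mul (by fun_prop)).mul
        continuousAt_const
    · rw [sub_self, Real.zero_rpow (by norm_num)]
      simp
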